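/- **Energy Lemma (Reissner–Mindlin plate with an inclusion).** Let $\Omega\subset\mathbb R^2$ be a bounded domain with boundary of Lipschitz class, let $D\subset\Omega$ be measurable, and let $h>0$. Write $\mathbb M^2$ for the real $2\times2$ matrices, $A\cdot B=A_{ij}B_{ij}$, $|A|^2=A\cdot A$, $\widehat A=\frac12(A+A^T)$ and $\widehat\nabla\varphi=\widehat{\nabla\varphi}$. Let $S,\widetilde S\in L^\infty(\Omega,\mathbb M^2)$ and $\mathbb P,\widetilde{\mathbb P}\in L^\infty(\Omega,\mathcal L(\mathbb M^2,\mathbb M^2))$ be such that, a.e. in $\Omega$, $S$ and $\widetilde S$ are symmetric and $\mathbb P$ and $\widetilde{\mathbb P}$ have the symmetries $L_{\alpha\beta\gamma\delta}=L_{\beta\alpha\gamma\delta}=L_{\alpha\beta\delta\gamma}=L_{\gamma\delta\alpha\beta}$. Assume that for constants $\sigma_0,\xi_0>0$ and $\sigma_1,\xi_1$, a.e. in $\Omega$, $$h\sigma_0|v|^2\le Sv\cdot v\le h\sigma_1|v|^2,\qquad \tfrac{h^3}{12}\xi_0|\widehat A|^2\le \mathbb PA\cdot A\le\tfrac{h^3}{12}\xi_1|\widehat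 A|^2$$ for all $v\in\mathbb R^2$ and $A\in\mathbb M^2$. Let $\overline Q\in H^{-1/2}(\partial\Omega)$ and $\overline M\in H^{-1/2}(\partial\Omega,\mathbb R^2)$, and let $(\varphi_0,w_0),(\varphi,w)\in H^1(\Omega,\mathbb R^2)\times H^1(\Omega)$ be weak solutions of the Neumann problems for the plate without and with the inclusion, that is, for all $(\psi,v)\in H^1(\Omega,\mathbb R^2)\times H^1(\Omega)$, $$\int_\Omega \mathbb P\nabla\varphi_0\cdot\nabla\psi+\int_\Omega S(\varphi_0+\nabla w_0)\cdot(\psi+\nabla v)=\int_{\partial\Omega}\overline Qv+\overline M\cdot\psi ,$$ and the same identity holds for $(\varphi,w)$ with $S,\mathbb P$ replaced by $\chi_{\Omega\setminus D}S+\chi_D\widetilde S$ and $\chi_{\Omega\setminus D}\mathbb P+\chi_D\widetilde{\mathbb P}$. Here $\int_{\partial\Omega}$ denotes the duality between $H^{-1/2}(\partial\Omega)$ and $H^{1/2}(\partial\Omega)$ applied to traces. Inequalities between tensors are understood as inequalities between the associated quadratic forms. (i) If $\eta>0$, $\delta>1$ and, a.e. in $\Omega$, $\eta S\le\widetilde S-S\le(\delta-1)S$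 and $\eta\mathbb P\le\widetilde{\mathbb P}-\mathbb P\le(\delta-1)\mathbb P$, then $$\frac\eta\delta\int_D\frac{h^3}{12}\xi_0|\widehat\nabla\varphi_0|^2+h\sigma_0|\varphi_0+\nabla w_0|^2\le\int_{\partial\Omega}\overline Q(w_0-w)+\overline M\cdot(\varphi_0-\varphi)\le(\delta-1)\int_D\frac{h^3}{12}\xi_1|\widehat\nabla\varphi_0|^2+h\sigma_1|\varphi_0+\nabla w_0|^2 .$$ (ii) If $\eta>0$, $0<\delta<1$ and, a.e. in $\Omega$, $-(1-\delta)S\le\widetilde S-S\le-\eta S$ and $-(1-\delta)\mathbb P\le\widetilde{\mathbb P}-\mathbb P\le-\eta\mathbb P$, then $$\eta\int_D\frac{h^3}{12}\xi_0|\widehat\nabla\varphi_0|^2+h\sigma_0|\varphi_0+\nabla w_0|^2\le\int_{\partial\Omega}\overline Q(w-w_0)+\overline M\cdot(\varphi-\varphi_0)\le\frac{1-\delta}\delta\int_D\frac{h^3}{12}\xi_1|\widehat\nabla\varphi_0|^2+h\sigma_1|\varphi_0+\nabla w_0|^2 .$$ -/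

import Mathlib

open MeasureTheory Filter Topology
open scoped ContDiff NNReal ENNReal Matrix

noncomputable section

namespace ReissnerMindlin

/-- The plane of the mid-surface of the plate, with its Euclidean structure. -/
abbrev Plane : Type := EuclideanSpace ℝ (Fin 2)

/-! ### Domains with Lipschitz boundary -/

/-- The boundary of `Ω` is of Lipschitz class with constants `ρ₀`, `M₀`: near each boundary point,
after a rigid change of coordinates `T` taking that point to the origin, `Ω` coincides in the
rectangle `|x₁| < ρ₀`, `|x₂| < M₀ ρ₀` with the region above the graph of a Lipschitz function `ψ`
vanishing at `0`, whose normalized norm `sup |ψ| + ρ₀ Lip(ψ)` is at most `M₀ ρ₀`. -/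
def IsLipschitzBoundaryWith (Ω : Set Plane) (ρ₀ M₀ : ℝ) : Prop :=
  ∀ p ∈ frontier Ω, ∃ T : Plane ≃ᵃⁱ[ℝ] Plane, T p = 0 ∧
    ∃ (ψ : ℝ → ℝ) (K : ℝ≥0), ψ 0 = 0 ∧
      LipschitzOnWith K ψ (Set.Ioo (-ρ₀) ρ₀) ∧
      (∀ t ∈ Set.Ioo (-ρ₀) ρ₀, |ψ t| + ρ₀ * K ≤ M₀ * ρ₀) ∧
      ∀ x : Plane, |x 0| < ρ₀ → |x 1| < M₀ * ρ₀ → (T.symm x ∈ Ω ↔ ψ (x 0) < x 1)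

/-- A bounded domain (nonempty connected open set) of the plane with boundary of Lipschitz
class. -/
structure IsBoundedLipschitzDomain (Ω : Set Plane) : Prop where
  isOpen : IsOpen Ω
  isConnected : IsConnected Ω
  isBounded : Bornology.IsBounded Ω
  lipschitz : ∃ ρ₀ M₀ : ℝ, 0 < ρ₀ ∧ 0 < M₀ ∧ IsLipschitzBoundaryWith Ω ρ₀ M₀

/-! ### The Sobolev space `H¹(Ω)` -/

/-- The classical partial derivative `∂ᵢ f`. -/
def partialDeriv (i : Fin 2) (f : Plane → ℝ) (x : Plane) : ℝ :=
  fderiv ℝ f x (EuclideanSpace.single i 1)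

/-- An element of `H¹(Ω)`: a function in `L²(Ω)` together with its weak gradient in `L²(Ω)`
(only the values in `Ω`, up to null sets, are relevant). -/
structure H1 (Ω : Set Plane) where
  toFun : Plane → ℝ
  grad : Fin 2 → Plane → ℝ
  memLp_toFun : MemLp toFun 2 (volume.restrict Ω)
  memLp_grad : ∀ i, MemLp (grad i) 2 (volume.restrict Ω)
  weak_grad : ∀ (i : Fin 2) (η : Plane → ℝ), ContDiff ℝ ∞ η → HasCompactSupport η →
    tsupport η ⊆ Ω →
    ∫ x in Ω, toFun x * partialDeriv i η x = -∫ x in Ω, grad i x * η x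

/-! ### Boundary spaces, traces, and the boundary duality -/

/-- Arc length (one-dimensional Hausdorff measure) on `∂Ω`. -/
def bdryMeasure (Ω : Set Plane) : Measure Plane :=
  (Measure.hausdorffMeasure 1).restrict (frontier Ω)

/-- The difference quotient `(g(x) - g(y)) / |x - y|`. Its squared `L²(∂Ω × ∂Ω)` norm is the
Gagliardo seminorm of order `1/2` on the one-dimensional set `∂Ω`. -/
def diffQuot (g : Plane → ℝ) (p : Plane × Plane) : ℝ :=
  (g p.1 - g p.2) / dist p.1 p.2

/-- The space `H^{1/2}(∂Ω)`: functions in `L²(∂Ω)` with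
`∬ |g(x) - g(y)|² / |x - y|² dσ(x) dσ(y) < ∞`. -/
def HHalf (Ω : Set Plane) : Submodule ℝ (Plane → ℝ) where
  carrier := {g | MemLp g 2 (bdryMeasure Ω) ∧
    MemLp (diffQuot g) 2 ((bdryMeasure Ω).prod (bdryMeasure Ω))}
  zero_mem' := by
    refine ⟨MemLp.zero', ?_⟩
    have h : diffQuot 0 = fun _ => 0 := by
      funext p
      simp [diffQuot]
    rw [h]
    exact MemLp.zero'
  add_mem' := by
    rintro f g ⟨hf, hf'⟩ ⟨hg, hg'⟩
    refine ⟨hf.add hg, ?_⟩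
    have h : diffQuot (f + g) = diffQuot f + diffQuot g := by
      funext p
      simp only [diffQuot, Pi.add_apply]
      ring
    rw [h]
    exact hf'.add hg'
  smul_mem' := by
    rintro c g ⟨hg, hg'⟩
    refine ⟨hg.const_smul c, ?_⟩
    have h : diffQuot (c • g) = c • diffQuot g := by
      funext p
      simp only [diffQuot, Pi.smul_apply, smul_eq_mul]
      ring
    rw [h]
    exact hg'.const_smul c

/-- The norm of `H^{1/2}(∂Ω)`. -/
def hHalfNorm {Ω : Set Plane} (g : HHalf Ω) : ℝ :=
  Real.sqrt ((eLpNorm (g : Plane → ℝ) 2 (bdryMeasure Ω)).toReal ^ 2 +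
    (eLpNorm (diffQuot (g : Plane → ℝ)) 2 ((bdryMeasure Ω).prod (bdryMeasure Ω))).toReal ^ 2)

/-- The dual space `H^{-1/2}(∂Ω)`: linear functionals on `H^{1/2}(∂Ω)` that are bounded in its
norm. The value `Q g` is what is written `∫_{∂Ω} Q g`. -/
structure HMinusHalf (Ω : Set Plane) extends HHalf Ω →ₗ[ℝ] ℝ where
  bounded : ∃ C : ℝ, ∀ g : HHalf Ω, |toLinearMap g| ≤ C * hHalfNorm g

/-- `g` is the trace of `w ∈ H¹(Ω)` on `∂Ω`: some sequence of smooth functions on the plane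
converges to `w` in `H¹(Ω)` while its restrictions to `∂Ω` converge to `g` in `L²(∂Ω)`.
On a bounded Lipschitz domain each `w ∈ H¹(Ω)` has exactly one trace (up to null sets), and it
belongs to `H^{1/2}(∂Ω)`. -/
def IsTrace {Ω : Set Plane} (w : H1 Ω) (g : HHalf Ω) : Prop :=
  ∃ f : ℕ → Plane → ℝ, (∀ n, ContDiff ℝ ∞ (f n)) ∧
    Tendsto (fun n => eLpNorm (f n - w.toFun) 2 (volume.restrict Ω)) atTop (𝓝 0) ∧
    (∀ i, Tendsto (fun n => eLpNorm (partialDeriv i (f n) - w.grad i) 2 (volume.restrict Ω))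
      atTop (𝓝 0)) ∧
    Tendsto (fun n => eLpNorm (f n - (g : Plane → ℝ)) 2 (bdryMeasure Ω)) atTop (𝓝 0)

/-- The work `∫_{∂Ω} Q g + M · k` of the loads `Q ∈ H^{-1/2}(∂Ω)`, `M ∈ H^{-1/2}(∂Ω, ℝ²)` on
`g ∈ H^{1/2}(∂Ω)`, `k ∈ H^{1/2}(∂Ω, ℝ²)`. -/
def work {Ω : Set Plane} (Q : HMinusHalf Ω) (M : Fin 2 → HMinusHalf Ω)
    (g : HHalf Ω) (k : Fin 2 → HHalf Ω) : ℝ :=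
  Q.toLinearMap g + ∑ i, (M i).toLinearMap (k i)

/-! ### Elastic tensors -/

/-- Second-order tensors, i.e. `2 × 2` real matrices. -/
abbrev Mat : Type := Matrix (Fin 2) (Fin 2) ℝ

/-- Linear maps from `2 × 2` matrices to `2 × 2` matrices, given by their components
`L_{ijkl}`. -/
abbrev Tensor4 : Type := Fin 2 → Fin 2 → Fin 2 → Fin 2 → ℝ

/-- `(L A)_{ij} = L_{ijkl} A_{kl}`. -/
def Tensor4.app (L : Tensor4) (A : Mat) : Mat :=
  Matrix.of fun i j => ∑ k, ∑ l, L i j k l * A k l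

/-- `A · B = A_{ij} B_{ij}`. -/
def frob (A B : Mat) : ℝ := ∑ i, ∑ j, A i j * B i j

/-- `Â = (A + Aᵀ) / 2`. -/
def symPart (A : Mat) : Mat := (1 / 2 : ℝ) • (A + Aᵀ)

/-- `S ∈ L^∞(Ω, 𝕄²)`. -/
def MemLinftyMat (Ω : Set Plane) (S : Plane → Mat) : Prop :=
  ∀ i j, MemLp (fun x => S x i j) ∞ (volume.restrict Ω)

/-- `P ∈ L^∞(Ω, 𝓛(𝕄², 𝕄²))`. -/
def MemLinftyTensor (Ω : Set Plane) (P : Plane → Tensor4) : Prop :=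
  ∀ i j k l, MemLp (fun x => P x i j k l) ∞ (volume.restrict Ω)

/-- Symmetry of a shearing tensor, a.e. in `Ω`. -/
def IsSymmShear (Ω : Set Plane) (S : Plane → Mat) : Prop :=
  ∀ᵐ x ∂volume.restrict Ω, ∀ a b, S x a b = S x b a

/-- Minor and major symmetries of a bending tensor, a.e. in `Ω`. -/
def IsSymmBending (Ω : Set Plane) (P : Plane → Tensor4) : Prop :=
  ∀ᵐ x ∂volume.restrict Ω, ∀ a b c d,
    P x a b c d = P x b a c d ∧ P x a b c d = P x a b d c ∧ P x a b c d = P x c d a b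

/-- `c₁ S ≤ T ≤ c₂ S` a.e. in `Ω`, as quadratic forms on vectors. -/
def ShearBetween (Ω : Set Plane) (c₁ c₂ : ℝ) (S T : Plane → Mat) : Prop :=
  ∀ᵐ x ∂volume.restrict Ω, ∀ v : Fin 2 → ℝ,
    c₁ * ((S x *ᵥ v) ⬝ᵥ v) ≤ (T x *ᵥ v) ⬝ᵥ v ∧ (T x *ᵥ v) ⬝ᵥ v ≤ c₂ * ((S x *ᵥ v) ⬝ᵥ v)

/-- `c₁ P ≤ T ≤ c₂ P` a.e. in `Ω`, as quadratic forms on `2 × 2` matrices. -/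
def BendingBetween (Ω : Set Plane) (c₁ c₂ : ℝ) (P T : Plane → Tensor4) : Prop :=
  ∀ᵐ x ∂volume.restrict Ω, ∀ A : Mat,
    c₁ * frob ((P x).app A) A ≤ frob ((T x).app A) A ∧
      frob ((T x).app A) A ≤ c₂ * frob ((P x).app A) A

/-- `h σ₀ |v|² ≤ S v · v ≤ h σ₁ |v|²` a.e. in `Ω`. -/
def ShearElliptic (Ω : Set Plane) (h σ₀ σ₁ : ℝ) (S : Plane → Mat) : Prop :=
  ∀ᵐ x ∂volume.restrict Ω, ∀ v : Fin 2 → ℝ,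
    h * σ₀ * (v ⬝ᵥ v) ≤ (S x *ᵥ v) ⬝ᵥ v ∧ (S x *ᵥ v) ⬝ᵥ v ≤ h * σ₁ * (v ⬝ᵥ v)

/-- `(h³/12) ξ₀ |Â|² ≤ P A · A ≤ (h³/12) ξ₁ |Â|²` a.e. in `Ω`. -/
def BendingElliptic (Ω : Set Plane) (h ξ₀ ξ₁ : ℝ) (P : Plane → Tensor4) : Prop :=
  ∀ᵐ x ∂volume.restrict Ω, ∀ A : Mat,
    h ^ 3 / 12 * ξ₀ * frob (symPart A) (symPart A) ≤ frob ((P x).app A) A ∧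
      frob ((P x).app A) A ≤ h ^ 3 / 12 * ξ₁ * frob (symPart A) (symPart A)

/-- The shearing tensor `χ_{Ω∖D} S + χ_D S'` of the plate with the inclusion. -/
def shearWithInclusion (Ω D : Set Plane) (S S' : Plane → Mat) (x : Plane) : Mat :=
  (Ω \ D).indicator S x + D.indicator S' x

/-- The bending tensor `χ_{Ω∖D} P + χ_D P'` of the plate with the inclusion. -/
def bendingWithInclusion (Ω D : Set Plane) (P P' : Plane → Tensor4) (x : Plane) : Tensor4 :=
  (Ω \ D).indicator P x + D.indicator P' x

/-! ### The Reissner-Mindlin Neumann problem -/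

/-- The matrix `∇φ`, with entries `(∇φ)_{ij} = ∂ⱼ φᵢ`. -/
def gradMat {Ω : Set Plane} (φ : Fin 2 → H1 Ω) (x : Plane) : Mat :=
  Matrix.of fun i j => (φ i).grad j x

/-- The shear strain `φ + ∇w`. -/
def shearStrain {Ω : Set Plane} (φ : Fin 2 → H1 Ω) (w : H1 Ω) (x : Plane) : Fin 2 → ℝ :=
  fun i => (φ i).toFun x + w.grad i x

/-- `(φ, w) ∈ H¹(Ω, ℝ²) × H¹(Ω)` is a weak solution of the Neumann problem
`div (S(φ + ∇w)) = 0`, `div (P ∇φ) - S(φ + ∇w) = 0` in `Ω`,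
`S(φ + ∇w) · n = Q`, `(P ∇φ) n = M` on `∂Ω`. -/
def IsWeakSolution (Ω : Set Plane) (S : Plane → Mat) (P : Plane → Tensor4)
    (Q : HMinusHalf Ω) (M : Fin 2 → HMinusHalf Ω) (φ : Fin 2 → H1 Ω) (w : H1 Ω) : Prop :=
  ∀ (ψ : Fin 2 → H1 Ω) (v : H1 Ω) (k : Fin 2 → HHalf Ω) (g : HHalf Ω),
    (∀ i, IsTrace (ψ i) (k i)) → IsTrace v g →
      (∫ x in Ω, frob ((P x).app (gradMat φ x)) (gradMat ψ x)) +
        (∫ x in Ω, (S x *ᵥ shearStrain φ w x) ⬝ᵥ shearStrain ψ v x) = work Q M g k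

/-- The integral `∫_D (h³/12) ξ |∇̂φ|² + h σ |φ + ∇w|²`. -/
def strainEnergy {Ω : Set Plane} (D : Set Plane) (h ξ σ : ℝ) (φ : Fin 2 → H1 Ω) (w : H1 Ω) : ℝ :=
  ∫ x in D, (h ^ 3 / 12 * ξ * frob (symPart (gradMat φ x)) (symPart (gradMat φ x)) +
    h * σ * (shearStrain φ w x ⬝ᵥ shearStrain φ w x))

end ReissnerMindlin

end

/-! Let `B` be the pointwise reference energy form, `B₁` the form of the plate with the inclusion
(`B'` in `D`, `B` elsewhere), `p` and `q` the strains of the reference and perturbed solutions, `L`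
the work functional, `u₀`, `u` the two solutions. Each solution is an admissible test field in both
problems, so `∫ B(p,p) = L(u₀) = ∫ B₁(q,p)` and `∫ B(p,q) = L(u) = ∫ B₁(q,q)`.

Hence `∫ B(p,p) - 2B₁(q,p) + B₁(q,q) = L(u) - L(u₀)` and `∫ B(p,p) - 2B(p,q) + B₁(q,q) = L(u₀) -
L(u)`. Off `D` both integrands equal `B(p-q,p-q) ≥ 0`. In `D`, completing a square bounds the first
below by `(1-c)B(p,p)` if `B' ≤ cB`, and the second by `(1-c⁻¹)B(p,p)` if `B' ≥ cB`. These are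
`one_sub_mul_energy_le_work` and `one_sub_inv_mul_energy_le_work`.

Taking for `c` the two comparison constants of each case bounds the work difference on both sides by
multiples of `∫_D B(p,p)`; ellipticity of `S` and `P` turns this integral into the stated strain
energies. -/

namespace ReissnerMindlin

/-! ### Completion of squares for a pair of symmetric forms -/

section Forms

variable {V : Type*} [AddCommGroup V] [Module ℝ V]

/-- The lower bound behind the comparison with the energy of the perturbed form `B'`. -/
theorem one_sub_mul_le_of_form_le (B B' : LinearMap.BilinForm ℝ V) (hB' : ∀ p q, B' p q = B' q p)
    (hnn : ∀ p, 0 ≤ B' p p) {c : ℝ} (hle : ∀ p, B' p p ≤ c * B p p) (p q : V) :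
    (1 - c) * B p p ≤ B p p - 2 * B' q p + B' q q := by
  have h1 := hnn (p - q)
  have h2 := hle p
  simp only [map_sub, LinearMap.sub_apply] at h1
  rw [hB' p q] at h1
  linarith

/-- The lower bound behind the comparison with the energy of the reference form `B`. -/
theorem one_sub_inv_mul_le_of_le_form (B B' : LinearMap.BilinForm ℝ V)
    (hB : ∀ p q, B p q = B q p) (hnn : ∀ p, 0 ≤ B p p) {c : ℝ} (hc : 0 < c)
    (hle : ∀ p, c * B p p ≤ B' p p) (p q : V) :
    (1 - c⁻¹) * B p p ≤ B p p - 2 * B p q + B' q q := by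
  -- The factor `c` is chosen so that the `q`-term of the scaled square is exactly `c * B q q`,
  -- which `B' q q` dominates.
  have h1 := mul_nonneg (inv_nonneg.2 hc.le) (hnn (p - c • q))
  have h2 := hle q
  simp only [map_sub, LinearMap.sub_apply, map_smul, LinearMap.smul_apply, smul_eq_mul] at h1
  rw [hB q p] at h1
  have h3 : c⁻¹ * (B p p - c * B p q - (c * B p q - c * (c * B q q))) =
      c⁻¹ * B p p - 2 * B p q + c * B q q := by
    field_simp
    ring
  linarith

end Forms

/-! ### The strain energy form of the plate -/

/-- The energy form `(A, v), (B, u) ↦ P A · B + S v · u` of the plate at a point. -/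
def strainForm (S : Mat) (P : Tensor4) : LinearMap.BilinForm ℝ (Mat × (Fin 2 → ℝ)) :=
  LinearMap.mk₂ ℝ (fun p q => frob (P.app p.1) q.1 + (S *ᵥ p.2) ⬝ᵥ q.2)
    (by intros; simp [frob, Tensor4.app, dotProduct, Matrix.mulVec, Fin.sum_univ_two]; ring)
    (by intros; simp [frob, Tensor4.app, dotProduct, Matrix.mulVec, Fin.sum_univ_two]; ring)
    (by intros; simp [frob, Tensor4.app, dotProduct, Matrix.mulVec, Fin.sum_univ_two]; ring)
    (by intros; simp [frob, Tensor4.app, dotProduct, Matrix.mulVec, Fin.sum_univ_two]; ring)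

theorem strainForm_apply (S : Mat) (P : Tensor4) (p q : Mat × (Fin 2 → ℝ)) :
    strainForm S P p q = frob (P.app p.1) q.1 + (S *ᵥ p.2) ⬝ᵥ q.2 := rfl

theorem strainForm_sub_apply (S S' : Mat) (P P' : Tensor4) (p q : Mat × (Fin 2 → ℝ)) :
    strainForm (S' - S) (P' - P) p q = strainForm S' P' p q - strainForm S P p q := by
  simp [strainForm_apply, frob, Tensor4.app, dotProduct, Matrix.mulVec, Fin.sum_univ_two]
  ring

theorem strainForm_comm {S : Mat} {P : Tensor4} (hS : ∀ a b, S a b = S b a)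
    (hP : ∀ a b c d, P a b c d = P c d a b) (p q : Mat × (Fin 2 → ℝ)) :
    strainForm S P p q = strainForm S P q p := by
  simp only [strainForm_apply, frob, Tensor4.app, dotProduct, Matrix.mulVec, Fin.sum_univ_two,
    Matrix.of_apply]
  rw [hS 1 0, hP 0 1 0 0, hP 1 0 0 0, hP 1 1 0 0, hP 1 0 0 1, hP 1 1 0 1, hP 1 1 1 0]
  ring

theorem frob_self_nonneg (A : Mat) : 0 ≤ frob A A :=
  Finset.sum_nonneg fun _ _ => Finset.sum_nonneg fun _ _ => mul_self_nonneg _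

/-- The pair `(∇φ, φ + ∇w)` of bending and shear strains. -/
def strain {Ω : Set Plane} (φ : Fin 2 → H1 Ω) (w : H1 Ω) (x : Plane) : Mat × (Fin 2 → ℝ) :=
  (gradMat φ x, shearStrain φ w x)

/-! ### Integrability -/

theorem memLp_shearStrain {Ω : Set Plane} (φ : Fin 2 → H1 Ω) (w : H1 Ω) (i : Fin 2) :
    MemLp (fun x => shearStrain φ w x i) 2 (volume.restrict Ω) :=
  (φ i).memLp_toFun.add (w.memLp_grad i)

/-- Hölder with exponents `∞, 2, 2`; the bending and shear densities are finite sums of such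
products. -/
theorem integrable_mul_mul {α : Type*} [MeasurableSpace α] {μ : Measure α} {a f g : α → ℝ}
    (ha : MemLp a ∞ μ) (hf : MemLp f 2 μ) (hg : MemLp g 2 μ) :
    Integrable (fun x => a x * f x * g x) μ :=
  (hf.mul' ha (r := 2)).integrable_mul hg

theorem integrable_bendingDensity {Ω : Set Plane} {P : Plane → Tensor4}
    (hP : MemLinftyTensor Ω P) (φ ψ : Fin 2 → H1 Ω) :
    Integrable (fun x => frob ((P x).app (gradMat φ x)) (gradMat ψ x)) (volume.restrict Ω) := by
  simp only [frob, Tensor4.app, Matrix.of_apply, gradMat, Finset.sum_mul]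
  refine integrable_finsetSum _ fun i _ => integrable_finsetSum _ fun j _ =>
    integrable_finsetSum _ fun k _ => integrable_finsetSum _ fun l _ => ?_
  exact integrable_mul_mul (hP i j k l) ((φ k).memLp_grad l) ((ψ i).memLp_grad j)

theorem integrable_shearDensity {Ω : Set Plane} {S : Plane → Mat}
    (hS : MemLinftyMat Ω S) (φ ψ : Fin 2 → H1 Ω) (w v : H1 Ω) :
    Integrable (fun x => (S x *ᵥ shearStrain φ w x) ⬝ᵥ shearStrain ψ v x)
      (volume.restrict Ω) := by
  simp only [dotProduct, Matrix.mulVec, Finset.sum_mul]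
  refine integrable_finsetSum _ fun i _ => integrable_finsetSum _ fun j _ => ?_
  exact integrable_mul_mul (hS i j) (memLp_shearStrain φ w j) (memLp_shearStrain ψ v i)

theorem integrable_strainForm {Ω : Set Plane} {S : Plane → Mat} {P : Plane → Tensor4}
    (hS : MemLinftyMat Ω S) (hP : MemLinftyTensor Ω P) (φ ψ : Fin 2 → H1 Ω) (w v : H1 Ω) :
    Integrable (fun x => strainForm (S x) (P x) (strain φ w x) (strain ψ v x))
      (volume.restrict Ω) :=
  (integrable_bendingDensity hP φ ψ).add (integrable_shearDensity hS φ ψ w v)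

theorem integrable_strainEnergy {Ω : Set Plane} (h ξ σ : ℝ) (φ : Fin 2 → H1 Ω) (w : H1 Ω) :
    Integrable (fun x => h ^ 3 / 12 * ξ * frob (symPart (gradMat φ x)) (symPart (gradMat φ x)) +
      h * σ * (shearStrain φ w x ⬝ᵥ shearStrain φ w x)) (volume.restrict Ω) := by
  refine Integrable.add (Integrable.const_mul ?_ _) (Integrable.const_mul ?_ _)
  · refine integrable_finsetSum _ fun i _ => integrable_finsetSum _ fun j _ => ?_
    have : MemLp (fun x => symPart (gradMat φ x) i j) 2 (volume.restrict Ω) :=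
      (((φ i).memLp_grad j).add ((φ j).memLp_grad i)).const_mul (1 / 2 : ℝ)
    exact this.integrable_mul this
  · refine integrable_finsetSum _ fun i _ => ?_
    exact (memLp_shearStrain φ w i).integrable_mul (memLp_shearStrain φ w i)

/-! ### The tensors of the plate with the inclusion -/

section Inclusion

variable {Ω D : Set Plane} {S S' : Plane → Mat} {P P' : Plane → Tensor4}

theorem shearWithInclusion_of_mem {x : Plane} (hx : x ∈ D) :
    shearWithInclusion Ω D S S' x = S' x := by
  simp [shearWithInclusion, hx]

theorem shearWithInclusion_of_mem_diff {x : Plane} (hx : x ∈ Ω \ D) :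
    shearWithInclusion Ω D S S' x = S x := by
  simp [shearWithInclusion, hx.1, hx.2]

theorem bendingWithInclusion_of_mem {x : Plane} (hx : x ∈ D) :
    bendingWithInclusion Ω D P P' x = P' x := by
  simp [bendingWithInclusion, hx]

theorem bendingWithInclusion_of_mem_diff {x : Plane} (hx : x ∈ Ω \ D) :
    bendingWithInclusion Ω D P P' x = P x := by
  simp [bendingWithInclusion, hx.1, hx.2]

theorem MemLinftyMat.withInclusion (hΩ : MeasurableSet Ω) (hD : MeasurableSet D)
    (hS : MemLinftyMat Ω S) (hS' : MemLinftyMat Ω S') :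
    MemLinftyMat Ω (shearWithInclusion Ω D S S') := by
  intro i j
  have key : (fun x => shearWithInclusion Ω D S S' x i j) =
      (Ω \ D).indicator (fun x => S x i j) + D.indicator (fun x => S' x i j) := by
    funext x
    by_cases h1 : x ∈ Ω <;> by_cases h2 : x ∈ D <;> simp [shearWithInclusion, h1, h2]
  rw [key]
  exact ((hS i j).indicator (hΩ.diff hD)).add ((hS' i j).indicator hD)

theorem MemLinftyTensor.withInclusion (hΩ : MeasurableSet Ω) (hD : MeasurableSet D)
    (hP : MemLinftyTensor Ω P) (hP' : MemLinftyTensor Ω P') :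
    MemLinftyTensor Ω (bendingWithInclusion Ω D P P') := by
  intro i j k l
  have key : (fun x => bendingWithInclusion Ω D P P' x i j k l) =
      (Ω \ D).indicator (fun x => P x i j k l) + D.indicator (fun x => P' x i j k l) := by
    funext x
    by_cases h1 : x ∈ Ω <;> by_cases h2 : x ∈ D <;> simp [bendingWithInclusion, h1, h2]
  rw [key]
  exact ((hP i j k l).indicator (hΩ.diff hD)).add ((hP' i j k l).indicator hD)

end Inclusion

/-! ### Weak solutions -/

/-- Merging bending and shear into one integral allows pointwise arguments on a single quadratic
form. -/
theorem IsWeakSolution.integral_strainForm {Ω : Set Plane} {S : Plane → Mat} {P : Plane → Tensor4}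
    {Q : HMinusHalf Ω} {M : Fin 2 → HMinusHalf Ω} {φ : Fin 2 → H1 Ω} {w : H1 Ω}
    (hsol : IsWeakSolution Ω S P Q M φ w) (hS : MemLinftyMat Ω S) (hP : MemLinftyTensor Ω P)
    {ψ : Fin 2 → H1 Ω} {v : H1 Ω} {k : Fin 2 → HHalf Ω} {g : HHalf Ω}
    (hk : ∀ i, IsTrace (ψ i) (k i)) (hg : IsTrace v g) :
    ∫ x in Ω, strainForm (S x) (P x) (strain φ w x) (strain ψ v x) = work Q M g k := by
  rw [← hsol ψ v k g hk hg]
  exact integral_add (integrable_bendingDensity hP φ ψ) (integrable_shearDensity hS φ ψ w v)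

theorem work_sub {Ω : Set Plane} (Q : HMinusHalf Ω) (M : Fin 2 → HMinusHalf Ω)
    (g g' : HHalf Ω) (k k' : Fin 2 → HHalf Ω) :
    work Q M (g - g') (k - k') = work Q M g k - work Q M g' k' := by
  simp only [work, Pi.sub_apply, map_sub, Finset.sum_sub_distrib]
  ring

/-- A pointwise lower bound, by `c f` in `D` and by `0` in `Ω \ D`, gives a lower bound of the
integral over `Ω`. -/
theorem mul_setIntegral_le_of_ae {α : Type*} [MeasurableSpace α] {μ : Measure α} {Ω D : Set α}
    (hD : MeasurableSet D) (hDΩ : D ⊆ Ω) {F f : α → ℝ} (c : ℝ)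
    (hF : IntegrableOn F Ω μ) (hf : IntegrableOn f Ω μ)
    (hin : ∀ᵐ x ∂μ.restrict Ω, x ∈ D → c * f x ≤ F x)
    (hout : ∀ᵐ x ∂μ.restrict Ω, x ∉ D → 0 ≤ F x) :
    c * ∫ x in D, f x ∂μ ≤ ∫ x in Ω, F x ∂μ := by
  -- With `D` written as `D ∩ Ω`, the left side becomes the integral over `Ω` of an indicator, and
  -- the integrands can be compared pointwise.
  rw [← integral_const_mul, ← Set.inter_eq_self_of_subset_left hDΩ,
    ← Measure.restrict_restrict hD, ← integral_indicator hD]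
  refine integral_mono_ae ((hf.const_mul c).indicator hD) hF ?_
  filter_upwards [hin, hout] with x h1 h2
  by_cases hx : x ∈ D
  · simpa [hx] using h1 hx
  · simpa [hx] using h2 hx

/-! ### Pointwise comparison of the energy forms and the two energy inequalities -/

section Energy

variable {Ω D : Set Plane} {S S' : Plane → Mat} {P P' : Plane → Tensor4}

theorem ae_strainForm_between {c₁ c₂ : ℝ} (hS : ShearBetween Ω c₁ c₂ S (S' - S))
    (hP : BendingBetween Ω c₁ c₂ P (P' - P)) :
    ∀ᵐ x ∂volume.restrict Ω, ∀ p,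
      (1 + c₁) * strainForm (S x) (P x) p p ≤ strainForm (S' x) (P' x) p p ∧
        strainForm (S' x) (P' x) p p ≤ (1 + c₂) * strainForm (S x) (P x) p p := by
  filter_upwards [hS, hP] with x h1 h2 p
  have h3 := strainForm_sub_apply (S x) (S' x) (P x) (P' x) p p
  obtain ⟨h4, h5⟩ := h1 p.2
  obtain ⟨h6, h7⟩ := h2 p.1
  simp only [Pi.sub_apply] at h4 h5 h6 h7
  simp only [strainForm_apply] at h3 ⊢
  change frob (Tensor4.app (P' x - P x) p.1) p.1 + _ = _ at h3
  constructor <;> linarith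

theorem ae_strainForm_comm (hS : IsSymmShear Ω S) (hP : IsSymmBending Ω P) :
    ∀ᵐ x ∂volume.restrict Ω, ∀ p q,
      strainForm (S x) (P x) p q = strainForm (S x) (P x) q p := by
  filter_upwards [hS, hP] with x h1 h2
  exact strainForm_comm h1 fun a b c d => (h2 a b c d).2.2

theorem ae_strainForm_elliptic {h σ₀ σ₁ ξ₀ ξ₁ : ℝ} (hS : ShearElliptic Ω h σ₀ σ₁ S)
    (hP : BendingElliptic Ω h ξ₀ ξ₁ P) :
    ∀ᵐ x ∂volume.restrict Ω, ∀ p,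
      h ^ 3 / 12 * ξ₀ * frob (symPart p.1) (symPart p.1) + h * σ₀ * (p.2 ⬝ᵥ p.2)
          ≤ strainForm (S x) (P x) p p ∧
        strainForm (S x) (P x) p p
          ≤ h ^ 3 / 12 * ξ₁ * frob (symPart p.1) (symPart p.1) + h * σ₁ * (p.2 ⬝ᵥ p.2) := by
  filter_upwards [hS, hP] with x h1 h2 p
  exact ⟨add_le_add (h2 p.1).1 (h1 p.2).1, add_le_add (h2 p.1).2 (h1 p.2).2⟩

theorem ae_strainForm_nonneg {h σ₀ σ₁ ξ₀ ξ₁ : ℝ} (hh : 0 < h) (hσ₀ : 0 < σ₀) (hξ₀ : 0 < ξ₀)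
    (hS : ShearElliptic Ω h σ₀ σ₁ S) (hP : BendingElliptic Ω h ξ₀ ξ₁ P) :
    ∀ᵐ x ∂volume.restrict Ω, ∀ p, 0 ≤ strainForm (S x) (P x) p p := by
  filter_upwards [ae_strainForm_elliptic hS hP] with x hx p
  refine le_trans (add_nonneg ?_ ?_) (hx p).1
  · exact mul_nonneg (by positivity) (frob_self_nonneg _)
  · exact mul_nonneg (by positivity) (Finset.sum_nonneg fun _ _ => mul_self_nonneg _)

/-- If the stiffness of the inclusion is at most `c` times the reference one, the work difference
is at least `1 - c` times the reference energy in the inclusion. -/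
theorem one_sub_mul_energy_le_work (hΩ : MeasurableSet Ω) (hD : MeasurableSet D) (hDΩ : D ⊆ Ω)
    (hS : MemLinftyMat Ω S) (hS' : MemLinftyMat Ω S')
    (hP : MemLinftyTensor Ω P) (hP' : MemLinftyTensor Ω P')
    (hcomm : ∀ᵐ x ∂volume.restrict Ω, ∀ p q,
      strainForm (S x) (P x) p q = strainForm (S x) (P x) q p)
    (hcomm' : ∀ᵐ x ∂volume.restrict Ω, ∀ p q,
      strainForm (S' x) (P' x) p q = strainForm (S' x) (P' x) q p)
    (hnn : ∀ᵐ x ∂volume.restrict Ω, ∀ p, 0 ≤ strainForm (S x) (P x) p p)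
    (hnn' : ∀ᵐ x ∂volume.restrict Ω, ∀ p, 0 ≤ strainForm (S' x) (P' x) p p)
    {c : ℝ} (hle : ∀ᵐ x ∂volume.restrict Ω, ∀ p,
      strainForm (S' x) (P' x) p p ≤ c * strainForm (S x) (P x) p p)
    {Q : HMinusHalf Ω} {M : Fin 2 → HMinusHalf Ω} {φ₀ φ : Fin 2 → H1 Ω} {w₀ w : H1 Ω}
    (hsol₀ : IsWeakSolution Ω S P Q M φ₀ w₀)
    (hsol : IsWeakSolution Ω (shearWithInclusion Ω D S S') (bendingWithInclusion Ω D P P')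
      Q M φ w)
    {k₀ k : Fin 2 → HHalf Ω} {g₀ g : HHalf Ω}
    (hk₀ : ∀ i, IsTrace (φ₀ i) (k₀ i)) (hk : ∀ i, IsTrace (φ i) (k i))
    (hg₀ : IsTrace w₀ g₀) (hg : IsTrace w g) :
    (1 - c) * ∫ x in D, strainForm (S x) (P x) (strain φ₀ w₀ x) (strain φ₀ w₀ x)
      ≤ work Q M (g - g₀) (k - k₀) := by
  have hS₁ := hS.withInclusion hΩ hD hS'
  have hP₁ := hP.withInclusion hΩ hD hP'
  have i₀ := integrable_strainForm hS hP φ₀ φ₀ w₀ w₀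
  have i₁ := integrable_strainForm hS₁ hP₁ φ φ₀ w w₀
  have i₂ := integrable_strainForm hS₁ hP₁ φ φ w w
  -- The cross term uses the perturbed form, so the integral is `L(u₀) - 2L(u₀) + L(u)`.
  have key := mul_setIntegral_le_of_ae hD hDΩ (1 - c) ((i₀.sub (i₁.const_mul 2)).add i₂) i₀ ?_ ?_
  · rw [integral_add' (i₀.sub (i₁.const_mul 2)) i₂, integral_sub' i₀ (i₁.const_mul 2),
      integral_const_mul, hsol₀.integral_strainForm hS hP hk₀ hg₀,
      hsol.integral_strainForm hS₁ hP₁ hk₀ hg₀, hsol.integral_strainForm hS₁ hP₁ hk hg] at key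
    rw [work_sub]
    linarith
  · filter_upwards [hcomm', hnn', hle] with x h1 h2 h3 hx
    simp only [Pi.add_apply, Pi.sub_apply, shearWithInclusion_of_mem hx,
      bendingWithInclusion_of_mem hx]
    exact one_sub_mul_le_of_form_le _ _ h1 h2 h3 _ _
  · filter_upwards [hcomm, hnn, ae_restrict_mem hΩ] with x h1 h2 hxΩ hx
    simp only [Pi.add_apply, Pi.sub_apply, shearWithInclusion_of_mem_diff ⟨hxΩ, hx⟩,
      bendingWithInclusion_of_mem_diff ⟨hxΩ, hx⟩]
    -- Off `D` the two forms coincide, so `c = 1` and the lower bound is zero.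
    simpa using one_sub_mul_le_of_form_le _ _ h1 h2 (c := 1) (fun p => (one_mul _).ge)
      (strain φ₀ w₀ x) (strain φ w x)

/-- If the stiffness of the inclusion is at least `c` times the reference one, the work difference
is at least `1 - c⁻¹` times the reference energy in the inclusion. -/
theorem one_sub_inv_mul_energy_le_work (hΩ : MeasurableSet Ω) (hD : MeasurableSet D)
    (hDΩ : D ⊆ Ω)
    (hS : MemLinftyMat Ω S) (hS' : MemLinftyMat Ω S')
    (hP : MemLinftyTensor Ω P) (hP' : MemLinftyTensor Ω P')
    (hcomm : ∀ᵐ x ∂volume.restrict Ω, ∀ p q,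
      strainForm (S x) (P x) p q = strainForm (S x) (P x) q p)
    (hnn : ∀ᵐ x ∂volume.restrict Ω, ∀ p, 0 ≤ strainForm (S x) (P x) p p)
    {c : ℝ} (hc : 0 < c) (hle : ∀ᵐ x ∂volume.restrict Ω, ∀ p,
      c * strainForm (S x) (P x) p p ≤ strainForm (S' x) (P' x) p p)
    {Q : HMinusHalf Ω} {M : Fin 2 → HMinusHalf Ω} {φ₀ φ : Fin 2 → H1 Ω} {w₀ w : H1 Ω}
    (hsol₀ : IsWeakSolution Ω S P Q M φ₀ w₀)
    (hsol : IsWeakSolution Ω (shearWithInclusion Ω D S S') (bendingWithInclusion Ω D P P')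
      Q M φ w)
    {k₀ k : Fin 2 → HHalf Ω} {g₀ g : HHalf Ω}
    (hk₀ : ∀ i, IsTrace (φ₀ i) (k₀ i)) (hk : ∀ i, IsTrace (φ i) (k i))
    (hg₀ : IsTrace w₀ g₀) (hg : IsTrace w g) :
    (1 - c⁻¹) * ∫ x in D, strainForm (S x) (P x) (strain φ₀ w₀ x) (strain φ₀ w₀ x)
      ≤ work Q M (g₀ - g) (k₀ - k) := by
  have hS₁ := hS.withInclusion hΩ hD hS'
  have hP₁ := hP.withInclusion hΩ hD hP'
  have i₀ := integrable_strainForm hS hP φ₀ φ₀ w₀ w₀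
  have i₁ := integrable_strainForm hS hP φ₀ φ w₀ w
  have i₂ := integrable_strainForm hS₁ hP₁ φ φ w w
  -- Here the cross term uses the reference form, so the integral is `L(u₀) - 2L(u) + L(u)`.
  have key := mul_setIntegral_le_of_ae hD hDΩ (1 - c⁻¹) ((i₀.sub (i₁.const_mul 2)).add i₂) i₀
    ?_ ?_
  · rw [integral_add' (i₀.sub (i₁.const_mul 2)) i₂, integral_sub' i₀ (i₁.const_mul 2),
      integral_const_mul, hsol₀.integral_strainForm hS hP hk₀ hg₀,
      hsol₀.integral_strainForm hS hP hk hg, hsol.integral_strainForm hS₁ hP₁ hk hg] at key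
    rw [work_sub]
    linarith
  · filter_upwards [hcomm, hnn, hle] with x h1 h2 h3 hx
    simp only [Pi.add_apply, Pi.sub_apply, shearWithInclusion_of_mem hx,
      bendingWithInclusion_of_mem hx]
    exact one_sub_inv_mul_le_of_le_form _ _ h1 h2 hc h3 _ _
  · filter_upwards [hcomm, hnn, ae_restrict_mem hΩ] with x h1 h2 hxΩ hx
    simp only [Pi.add_apply, Pi.sub_apply, shearWithInclusion_of_mem_diff ⟨hxΩ, hx⟩,
      bendingWithInclusion_of_mem_diff ⟨hxΩ, hx⟩]
    simpa using one_sub_inv_mul_le_of_le_form _ _ h1 h2 one_pos (fun p => (one_mul _).le)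
      (strain φ₀ w₀ x) (strain φ w x)

end Energy

end ReissnerMindlin

/-! ### The energy lemma for stiffer and softer inclusions -/

theorem lemma5p1
    (Ω D : Set ReissnerMindlin.Plane)
    (hΩ : ReissnerMindlin.IsBoundedLipschitzDomain Ω)
    (hD : MeasurableSet D) (hDΩ : D ⊆ Ω)
    (h σ₀ σ₁ ξ₀ ξ₁ : ℝ) (hh : 0 < h) (hσ₀ : 0 < σ₀) (hξ₀ : 0 < ξ₀)
    (S S' : ReissnerMindlin.Plane → ReissnerMindlin.Mat)
    (P P' : ReissnerMindlin.Plane → ReissnerMindlin.Tensor4)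
    (hS : ReissnerMindlin.MemLinftyMat Ω S) (hS' : ReissnerMindlin.MemLinftyMat Ω S')
    (hP : ReissnerMindlin.MemLinftyTensor Ω P) (hP' : ReissnerMindlin.MemLinftyTensor Ω P')
    (hSsymm : ReissnerMindlin.IsSymmShear Ω S) (hS'symm : ReissnerMindlin.IsSymmShear Ω S')
    (hPsymm : ReissnerMindlin.IsSymmBending Ω P) (hP'symm : ReissnerMindlin.IsSymmBending Ω P')
    (hSell : ReissnerMindlin.ShearElliptic Ω h σ₀ σ₁ S)
    (hPell : ReissnerMindlin.BendingElliptic Ω h ξ₀ ξ₁ P)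
    (Q : ReissnerMindlin.HMinusHalf Ω) (M : Fin 2 → ReissnerMindlin.HMinusHalf Ω)
    (φ₀ φ : Fin 2 → ReissnerMindlin.H1 Ω) (w₀ w : ReissnerMindlin.H1 Ω)
    (hsol₀ : ReissnerMindlin.IsWeakSolution Ω S P Q M φ₀ w₀)
    (hsol : ReissnerMindlin.IsWeakSolution Ω (ReissnerMindlin.shearWithInclusion Ω D S S')
      (ReissnerMindlin.bendingWithInclusion Ω D P P') Q M φ w)
    (k₀ k : Fin 2 → ReissnerMindlin.HHalf Ω) (g₀ g : ReissnerMindlin.HHalf Ω)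
    (hk₀ : ∀ i, ReissnerMindlin.IsTrace (φ₀ i) (k₀ i))
    (hk : ∀ i, ReissnerMindlin.IsTrace (φ i) (k i))
    (hg₀ : ReissnerMindlin.IsTrace w₀ g₀) (hg : ReissnerMindlin.IsTrace w g)
    (η δ : ℝ) (hη : 0 < η) :
    (1 < δ →
      ReissnerMindlin.ShearBetween Ω η (δ - 1) S (S' - S) →
      ReissnerMindlin.BendingBetween Ω η (δ - 1) P (P' - P) →
        η / δ * ReissnerMindlin.strainEnergy D h ξ₀ σ₀ φ₀ w₀
            ≤ ReissnerMindlin.work Q M (g₀ - g) (k₀ - k) ∧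
          ReissnerMindlin.work Q M (g₀ - g) (k₀ - k)
            ≤ (δ - 1) * ReissnerMindlin.strainEnergy D h ξ₁ σ₁ φ₀ w₀) ∧
    (0 < δ → δ < 1 →
      ReissnerMindlin.ShearBetween Ω (-(1 - δ)) (-η) S (S' - S) →
      ReissnerMindlin.BendingBetween Ω (-(1 - δ)) (-η) P (P' - P) →
        η * ReissnerMindlin.strainEnergy D h ξ₀ σ₀ φ₀ w₀
            ≤ ReissnerMindlin.work Q M (g - g₀) (k - k₀) ∧
          ReissnerMindlin.work Q M (g - g₀) (k - k₀)
            ≤ (1 - δ) / δ * ReissnerMindlin.strainEnergy D h ξ₁ σ₁ φ₀ w₀) := by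
  have hΩm : MeasurableSet Ω := hΩ.isOpen.measurableSet
  have hcomm := ReissnerMindlin.ae_strainForm_comm hSsymm hPsymm
  have hcomm' := ReissnerMindlin.ae_strainForm_comm hS'symm hP'symm
  have hnn := ReissnerMindlin.ae_strainForm_nonneg hh hσ₀ hξ₀ hSell hPell
  have hrestr := Measure.restrict_mono hDΩ (le_refl (volume : Measure ReissnerMindlin.Plane))
  have hint := (ReissnerMindlin.integrable_strainForm hS hP φ₀ φ₀ w₀ w₀).mono_measure hrestr
  have hell := (ReissnerMindlin.ae_strainForm_elliptic hSell hPell).filter_mono (ae_mono hrestr)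
  have hE₀ : ReissnerMindlin.strainEnergy D h ξ₀ σ₀ φ₀ w₀ ≤
      ∫ x in D, ReissnerMindlin.strainForm (S x) (P x) (ReissnerMindlin.strain φ₀ w₀ x) (ReissnerMindlin.strain φ₀ w₀ x) :=
    integral_mono_ae ((ReissnerMindlin.integrable_strainEnergy h ξ₀ σ₀ φ₀ w₀).mono_measure hrestr) hint
      (hell.mono fun x hx => (hx (ReissnerMindlin.strain φ₀ w₀ x)).1)
  have hE₁ : ∫ x in D, ReissnerMindlin.strainForm (S x) (P x) (ReissnerMindlin.strain φ₀ w₀ x) (ReissnerMindlin.strain φ₀ w₀ x) ≤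
      ReissnerMindlin.strainEnergy D h ξ₁ σ₁ φ₀ w₀ :=
    integral_mono_ae hint ((ReissnerMindlin.integrable_strainEnergy h ξ₁ σ₁ φ₀ w₀).mono_measure hrestr)
      (hell.mono fun x hx => (hx (ReissnerMindlin.strain φ₀ w₀ x)).2)
  have hI : 0 ≤ ∫ x in D, ReissnerMindlin.strainForm (S x) (P x) (ReissnerMindlin.strain φ₀ w₀ x) (ReissnerMindlin.strain φ₀ w₀ x) :=
    integral_nonneg_of_ae ((hnn.filter_mono (ae_mono hrestr)).mono fun x hx => hx _)
  constructor
  · intro hδ hSb hPb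
    have hb := ReissnerMindlin.ae_strainForm_between hSb hPb
    -- Chaining both bounds on the perturbed form gives `(1 + η) I ≤ δ I`, used below to weaken `η /
    -- (1 + η)` to `η / δ`.
    have hηδ := integral_mono_ae (hint.const_mul (1 + η)) (hint.const_mul (1 + (δ - 1)))
      ((hb.filter_mono (ae_mono hrestr)).mono fun x hx => (hx (ReissnerMindlin.strain φ₀ w₀ x)).1.trans (hx _).2)
    rw [integral_const_mul, integral_const_mul] at hηδ
    have hup := ReissnerMindlin.one_sub_mul_energy_le_work hΩm hD hDΩ hS hS' hP hP' hcomm hcomm' hnn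
      (by filter_upwards [hnn, hb] with x h1 h2 p
          exact (mul_nonneg (by positivity) (h1 p)).trans (h2 p).1)
      (hb.mono fun x hx p => (hx p).2) hsol₀ hsol hk₀ hk hg₀ hg
    have hlow := ReissnerMindlin.one_sub_inv_mul_energy_le_work hΩm hD hDΩ hS hS' hP hP' hcomm hnn
      (by positivity : 0 < 1 + η) (hb.mono fun x hx p => (hx p).1) hsol₀ hsol hk₀ hk hg₀ hg
    set I := ∫ x in D, ReissnerMindlin.strainForm (S x) (P x) (ReissnerMindlin.strain φ₀ w₀ x) (ReissnerMindlin.strain φ₀ w₀ x)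
    rw [ReissnerMindlin.work_sub] at hup hlow ⊢
    constructor
    · calc η / δ * ReissnerMindlin.strainEnergy D h ξ₀ σ₀ φ₀ w₀ ≤ η / δ * I := by gcongr
        _ ≤ (1 - (1 + η)⁻¹) * I := by
          have : (1 - (1 + η)⁻¹) * I - η / δ * I =
              η / (δ * (1 + η)) * ((1 + (δ - 1)) * I - (1 + η) * I) := by
            field_simp
            ring
          have h2 := mul_nonneg (by positivity : 0 ≤ η / (δ * (1 + η))) (sub_nonneg.2 hηδ)
          linarith
        _ ≤ _ := hlow
    -- `hup` has `c = δ` and bounds the opposite work difference below by `(1 - δ) I`; changing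
    -- signs gives the upper bound.
    · have := mul_le_mul_of_nonneg_left hE₁ (by linarith : 0 ≤ δ - 1)
      linarith
  · intro hδ hδ1 hSb hPb
    have hb := ReissnerMindlin.ae_strainForm_between hSb hPb
    -- For a softer inclusion the two inequalities swap roles: this one, with `c = 1 - η`, gives the
    -- lower bound, and the other, with `c = δ`, the upper.
    have hlow := ReissnerMindlin.one_sub_mul_energy_le_work hΩm hD hDΩ hS hS' hP hP' hcomm hcomm' hnn
      (by filter_upwards [hnn, hb] with x h1 h2 p
          exact (mul_nonneg (by linarith) (h1 p)).trans (h2 p).1)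
      (hb.mono fun x hx p => (hx p).2) hsol₀ hsol hk₀ hk hg₀ hg
    have hup := ReissnerMindlin.one_sub_inv_mul_energy_le_work hΩm hD hDΩ hS hS' hP hP' hcomm hnn
      (by linarith : 0 < 1 + -(1 - δ)) (hb.mono fun x hx p => (hx p).1)
      hsol₀ hsol hk₀ hk hg₀ hg
    set I := ∫ x in D, ReissnerMindlin.strainForm (S x) (P x) (ReissnerMindlin.strain φ₀ w₀ x) (ReissnerMindlin.strain φ₀ w₀ x)
    rw [ReissnerMindlin.work_sub] at hup hlow ⊢
    constructor
    · have := mul_le_mul_of_nonneg_left hE₀ hη.le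
      linarith
    · have h1 := mul_le_mul_of_nonneg_left hE₁ (div_nonneg (by linarith) hδ.le : 0 ≤ (1 - δ) / δ)
      have h2 : (1 - (1 + -(1 - δ))⁻¹) = -((1 - δ) / δ) := by
        rw [show 1 + -(1 - δ) = δ by ring]
        field_simp
        ring
      rw [h2] at hup
      linarith
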